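/- Let $\mathbb{B}=\{x\in\mathbb{R}^2:\|x\|\le 1\}$ be the closed unit disk with the Euclidean metric $d$, and let $k\ge 1$ be a fixed integer. A social group starts with members $G^0=\{v_1,\dots,v_k\}$, and in each round $t=1,2,3,\dots$ two candidates $w^t_1,w^t_2$ apply, where $v_1,\dots,v_k$ and all $w^t_j$ ($t\ge1$, $j=1,2$) are independent and uniformly distributed on $\mathbb{B}$. Each member $v\in G^{t-1}$ votes for a candidate that is closest to $v$ (that is, $v$ votes for $w^t_i$ if and only if $d(v,w^t_i)\le d(v,w^t_j)$ for the other candidate $w^t_j$). A candidate for whom every member of $G^{t-1}$ votes is accepted and added to the group, which gives $G^t$; if there is no such candidate, then $G^t=G^{t-1}$. Then $\mathbb{E}[|G^T|]\cong T^{1/8}$: there are constants $c,C>0$, depending only on $k$, such that for every integer $T\ge 1$, $$c\,T^{1/8}\ \le\ \mathbb{E}\big[\,|G^T|\,\big]\ \le\ C\,T^{1/8}.$$ -/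

import Mathlib

open MeasureTheory ProbabilityTheory

/-- The member located at `v` votes for the candidate located at `w` when `w` is a member of the
candidate set `C` that is closest to `v` (a member who is equidistant votes for every closest
candidate). -/
def VotesFor {K : Type*} [MetricSpace K] (C : Finset K) (v w : K) : Prop :=
  w ∈ C ∧ ∀ w' ∈ C, dist v w ≤ dist v w'

/-- Consensus voting: the candidate `w ∈ C` is accepted by the group `G` when every member of `G`
votes for `w`. -/
def IsAccepted {K : Type*} [MetricSpace K] (G C : Finset K) (w : K) : Prop :=
  w ∈ C ∧ ∀ v ∈ G, VotesFor C v w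

open Classical in
/-- The social group after `t` rounds of consensus voting, started from the group `G₀`, where `C t`
is the set of candidates of round number `t + 1` (so the rounds are numbered `1, 2, 3, …`). -/
noncomputable def socialGroup {K : Type*} [MetricSpace K] (G₀ : Finset K) (C : ℕ → Finset K) :
    ℕ → Finset K
  | 0 => G₀
  | t + 1 => socialGroup G₀ C t ∪ (C t).filter fun w => IsAccepted (socialGroup G₀ C t) (C t) w

/-- The Euclidean plane. -/
abbrev Plane : Type := EuclideanSpace ℝ (Fin 2)

/-- The closed unit ball of the Euclidean plane. -/
def unitBall : Set Plane := Metric.closedBall 0 1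

open Classical in
/-- The social group after `T` rounds, at the sample point `ω`: the initial members are located at
`v 0 ω, …, v (k - 1) ω`, and the two candidates of round number `t + 1` are located at `w t 0 ω` and
`w t 1 ω`. -/
noncomputable def randomGroup {Ω : Type*} {k : ℕ} (v : Fin k → Ω → Plane)
    (w : ℕ → Fin 2 → Ω → Plane) (T : ℕ) (ω : Ω) : Finset Plane :=
  socialGroup (Finset.univ.image fun i => v i ω) (fun t => {w t 0 ω, w t 1 ω}) T

/-! A candidate is accepted exactly when no member lies strictly beyond the bisector of the pair, in
the cap of the other candidate. A cap of height of order δ² has width of order δ. The outer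
candidate must lie in that cap (area of order δ³), and the difference of the pair has length O(δ²)
and is radial up to an angle O(δ) (area of order δ² · δ³). So such pairs have probability of order
δ^8. `dist_le_dist_of_mem_successSet` shows that enough of these pairs put a member into an empty
cap; `exists_bisectorSet` shows that every accepted pair is of this kind at some dyadic scale.

Lower bound (`le_integral_card_pow`): let a be the expected final size. Among n ≈ 2a disjoint caps
of width of order 1/n, at least a are empty on average in every round, so a round accepts with
probability at least of order a · a^(-8). Summing over T rounds gives T · a^(-7) ≲ a.

Upper bound (`sum_prob_acceptance_le`): a cap of scale δ is filled at rate δ^8 while empty, so it is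
empty for O(δ^(-8)) expected rounds and accounts for O(1) acceptances. The O(1/δ) caps of scale δ
account for O(1/δ), and the sum over dyadic δ down to T^(-1/8) is geometric. Smaller caps contribute
O(T · δ^7) = O(1/δ) at the last scale. -/

/-! ### Geometry of the disk -/

/-- Orthonormal bases of the plane. -/
abbrev PlaneBasis : Type := OrthonormalBasis (Fin 2) ℝ Plane

lemma PlaneBasis.inner_eq (b : PlaneBasis) (x y : Plane) :
    inner ℝ x y = inner ℝ (b 0) x * inner ℝ (b 0) y + inner ℝ (b 1) x * inner ℝ (b 1) y := by
  rw [← b.sum_inner_mul_inner x y, Fin.sum_univ_two, real_inner_comm x, real_inner_comm x]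

lemma PlaneBasis.norm_sq_eq (b : PlaneBasis) (x : Plane) :
    ‖x‖ ^ 2 = inner ℝ (b 0) x ^ 2 + inner ℝ (b 1) x ^ 2 := by
  rw [← real_inner_self_eq_norm_sq, b.inner_eq]; ring

lemma mem_unitBall_iff (x : Plane) : x ∈ unitBall ↔ ‖x‖ ≤ 1 := by
  simp [unitBall]

lemma PlaneBasis.mem_unitBall_iff (b : PlaneBasis) (x : Plane) :
    x ∈ unitBall ↔ inner ℝ (b 0) x ^ 2 + inner ℝ (b 1) x ^ 2 ≤ 1 := by
  rw [_root_.mem_unitBall_iff, ← b.norm_sq_eq, sq_le_one_iff₀ (norm_nonneg x)]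

/-- The rectangle with sides parallel to the axes of the basis `b`. -/
def rectangle (b : PlaneBasis) (a₀ a₁ c₀ c₁ : ℝ) : Set Plane :=
  {x | inner ℝ (b 0) x ∈ Set.Icc a₀ a₁ ∧ inner ℝ (b 1) x ∈ Set.Icc c₀ c₁}

lemma measurableSet_rectangle (b : PlaneBasis) (a₀ a₁ c₀ c₁ : ℝ) :
    MeasurableSet (rectangle b a₀ a₁ c₀ c₁) := by
  have h (i : Fin 2) : Measurable fun x : Plane => inner ℝ (b i) x := by fun_prop
  exact (h 0 measurableSet_Icc).inter (h 1 measurableSet_Icc)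

lemma volume_rectangle (b : PlaneBasis) (a₀ a₁ c₀ c₁ : ℝ) :
    volume (rectangle b a₀ a₁ c₀ c₁) = ENNReal.ofReal (a₁ - a₀) * ENNReal.ofReal (c₁ - c₀) := by
  have h := (PiLp.volume_preserving_ofLp (Fin 2)).comp b.measurePreserving_repr
  have e : rectangle b a₀ a₁ c₀ c₁ = (WithLp.ofLp ∘ b.repr) ⁻¹'
      Set.Icc (![a₀, c₀]) (![a₁, c₁]) := by
    ext x
    simp only [rectangle, Set.mem_ofPred_eq, Set.mem_preimage, Function.comp, Set.mem_Icc,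
      Pi.le_def, Fin.forall_fin_two, OrthonormalBasis.repr_apply_apply]
    simp
    tauto
  rw [e, h.measure_preimage measurableSet_Icc.nullMeasurableSet, Real.volume_Icc_pi]
  simp

lemma measurableSet_shear {A B : Set Plane} (hA : MeasurableSet A) (hB : MeasurableSet B) :
    MeasurableSet {z : Plane × Plane | z.1 ∈ A ∧ z.2 - z.1 ∈ B} :=
  (measurable_fst hA).inter ((measurable_snd.sub measurable_fst) hB)

/-- The shear (x, y) ↦ (x, y - x) preserves volume, by translation invariance on each fibre. -/
lemma volume_prod_shear {A B : Set Plane} (hA : MeasurableSet A) (hB : MeasurableSet B) :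
    (volume.prod volume) {z : Plane × Plane | z.1 ∈ A ∧ z.2 - z.1 ∈ B} = volume A * volume B := by
  rw [Measure.prod_apply (measurableSet_shear hA hB)]
  have (x : Plane) : volume (Prod.mk x ⁻¹' {z : Plane × Plane | z.1 ∈ A ∧ z.2 - z.1 ∈ B})
      = A.indicator (fun _ => volume B) x := by
    by_cases hx : x ∈ A
    · simp only [hx, Set.indicator_of_mem, Set.preimage_ofPred_eq, true_and]
      simp_rw [sub_eq_add_neg]
      exact measure_preimage_add_right volume (-x) B
    · simp [hx]
  simp_rw [this]
  rw [lintegral_indicator hA]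
  simp [mul_comm]

/-! ### Caps and the sets of pairs attached to them -/

/-- The cap in direction `b 0` of height `δ ^ 2 / 2` contains no member of `G`. -/
def EmptyCap (b : PlaneBasis) (δ : ℝ) (G : Finset Plane) : Prop :=
  ∀ v ∈ G, inner ℝ (b 0) v ≤ 1 - δ ^ 2 / 2

/-- A set of pairs of candidates whose first member lies in the cap in direction `b 0` and is
accepted whenever that cap is empty. -/
def successSet (b : PlaneBasis) (δ : ℝ) : Set (Plane × Plane) :=
  {z | z.1 ∈ rectangle b (1 - 0.45 * δ ^ 2) (1 - 0.4 * δ ^ 2) (-(δ / 10)) (δ / 10) ∧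
    z.2 - z.1 ∈ rectangle b (0.15 * δ ^ 2) (0.2 * δ ^ 2) (-(δ ^ 3 / 100)) (δ ^ 3 / 100)}

/-- A set of pairs of candidates that contains all those whose bisector cuts off a cap of height
at most `4 * δ ^ 2` in a direction close to `b 0`. -/
def bisectorSet (b : PlaneBasis) (δ : ℝ) : Set (Plane × Plane) :=
  {z | z.2 ∈ rectangle b (1 - 6 * δ ^ 2) 1 (-(4 * δ)) (4 * δ) ∧
    z.1 - z.2 ∈ rectangle b (-(8 * δ ^ 2)) (8 * δ ^ 2) (-(2 * δ ^ 3)) (2 * δ ^ 3)}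

lemma measurableSet_successSet (b : PlaneBasis) (δ : ℝ) : MeasurableSet (successSet b δ) :=
  measurableSet_shear (measurableSet_rectangle ..) (measurableSet_rectangle ..)

lemma measurableSet_bisectorSet (b : PlaneBasis) (δ : ℝ) : MeasurableSet (bisectorSet b δ) :=
  (measurable_snd (measurableSet_rectangle ..)).inter
    ((measurable_fst.sub measurable_snd) (measurableSet_rectangle ..))

/-- The exponent 8 comes from the side lengths, of orders δ² and δ for the position, δ² and δ³ for
the difference. -/
lemma volume_successSet (b : PlaneBasis) {δ : ℝ} (hδ : 0 < δ) :
    (volume.prod volume) (successSet b δ) = ENNReal.ofReal (δ ^ 8 / 100000) := by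
  rw [successSet, volume_prod_shear (measurableSet_rectangle ..) (measurableSet_rectangle ..),
    volume_rectangle, volume_rectangle, ← ENNReal.ofReal_mul, ← ENNReal.ofReal_mul,
    ← ENNReal.ofReal_mul]
  · congr 1; ring
  all_goals ring_nf; positivity

lemma volume_bisectorSet (b : PlaneBasis) {δ : ℝ} (hδ : 0 < δ) :
    (volume.prod volume) (bisectorSet b δ) = ENNReal.ofReal (3072 * δ ^ 8) := by
  have e : bisectorSet b δ = Prod.swap ⁻¹' {z : Plane × Plane |
      z.1 ∈ rectangle b (1 - 6 * δ ^ 2) 1 (-(4 * δ)) (4 * δ) ∧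
      z.2 - z.1 ∈ rectangle b (-(8 * δ ^ 2)) (8 * δ ^ 2) (-(2 * δ ^ 3)) (2 * δ ^ 3)} := rfl
  rw [e, Measure.measurePreserving_swap.measure_preimage
    (measurableSet_shear (measurableSet_rectangle ..)
      (measurableSet_rectangle ..)).nullMeasurableSet,
    volume_prod_shear (measurableSet_rectangle ..) (measurableSet_rectangle ..),
    volume_rectangle, volume_rectangle, ← ENNReal.ofReal_mul, ← ENNReal.ofReal_mul,
    ← ENNReal.ofReal_mul]
  · congr 1; ring
  all_goals ring_nf; positivity

section Success

variable {b : PlaneBasis} {δ : ℝ} {w₁ w₂ : Plane}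

lemma successSet_subset_unitBall (hδ : 0 < δ) (hδ1 : δ ≤ 1) (h : (w₁, w₂) ∈ successSet b δ) :
    w₁ ∈ unitBall ∧ w₂ ∈ unitBall := by
  obtain ⟨⟨⟨h1, h2⟩, h3, h4⟩, ⟨h5, h6⟩, h7, h8⟩ := h
  simp only [inner_sub_right] at h1 h2 h3 h4 h5 h6 h7 h8
  have hδ2 : δ ^ 2 ≤ 1 := pow_le_one₀ hδ.le hδ1
  have hδ3 : δ ^ 3 ≤ δ := by nlinarith
  constructor
  · rw [b.mem_unitBall_iff]
    have : inner ℝ (b 1) w₁ ^ 2 ≤ (δ / 10) ^ 2 := sq_le_sq' h3 h4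
    nlinarith [sq_nonneg δ]
  · rw [b.mem_unitBall_iff]
    have : inner ℝ (b 1) w₂ ^ 2 ≤ (δ / 5) ^ 2 := sq_le_sq' (by linarith) (by linarith)
    nlinarith [sq_nonneg δ]

lemma first_mem_cap_of_mem_successSet (hδ : 0 < δ) (h : (w₁, w₂) ∈ successSet b δ) :
    1 - δ ^ 2 / 2 < inner ℝ (b 0) w₁ := by
  have := h.1.1.1
  dsimp only at this
  nlinarith [sq_pos_of_pos hδ]

/-- Half the difference of the squared distances is a radial gain `r * (s - 1 + A + r / 2)` minus a
tangential loss `τ * (Q - B - τ / 2)`, where `s` is the depth of `v`. Since `v` is in the disk, |Q|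
≤ √(2s); the loss is at most 0.024 δ² s and the gain at least 0.0375 δ² s. -/
lemma dist_le_dist_of_mem_successSet (hδ : 0 < δ) (hδ1 : δ ≤ 1) (h : (w₁, w₂) ∈ successSet b δ)
    {v : Plane} (hv : v ∈ unitBall) (hcap : inner ℝ (b 0) v ≤ 1 - δ ^ 2 / 2) :
    dist v w₁ ≤ dist v w₂ := by
  obtain ⟨⟨⟨h1, h2⟩, h3, h4⟩, ⟨h5, h6⟩, h7, h8⟩ := h
  rw [b.mem_unitBall_iff] at hv
  rw [dist_eq_norm, dist_eq_norm, ← sq_le_sq₀ (norm_nonneg _) (norm_nonneg _), b.norm_sq_eq,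
    b.norm_sq_eq]
  simp only [inner_sub_right] at *
  generalize inner ℝ (b 0) w₁ = A at *
  generalize inner ℝ (b 1) w₁ = B at *
  generalize inner ℝ (b 0) w₂ = A' at *
  generalize inner ℝ (b 1) w₂ = B' at *
  generalize inner ℝ (b 0) v = V at *
  generalize inner ℝ (b 1) v = Q at *
  obtain ⟨r, rfl⟩ : ∃ r, A' = A + r := ⟨A' - A, by ring⟩
  obtain ⟨τ, rfl⟩ : ∃ τ, B' = B + τ := ⟨B' - B, by ring⟩
  obtain ⟨s, rfl⟩ : ∃ s, V = 1 - s := ⟨1 - V, by ring⟩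
  simp only [add_sub_cancel_left] at *
  have hs : δ ^ 2 / 2 ≤ s := by linarith
  have hδ2 : δ ^ 2 ≤ 1 := pow_le_one₀ hδ.le hδ1
  have hδ3 : δ ^ 3 ≤ δ := by nlinarith
  have hδp : 0 < δ ^ 2 := by positivity
  set R := √(2 * s) with hR
  have hR2 : R ^ 2 = 2 * s := Real.sq_sqrt (by linarith)
  have hδR : δ ≤ R := Real.le_sqrt_of_sq_le (by linarith)
  have hQ : |Q| ≤ R := Real.abs_le_sqrt (by nlinarith [sq_nonneg s])
  rw [abs_le] at hQ
  have hτ : |τ| ≤ δ ^ 3 / 100 := abs_le.2 ⟨by linarith, h8⟩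
  have hW : |Q - B - τ / 2| ≤ 1.2 * R := abs_le.2 ⟨by linarith, by linarith⟩
  have key1 : τ * (Q - B - τ / 2) ≤ δ ^ 3 / 100 * (1.2 * R) := by
    calc τ * (Q - B - τ / 2) ≤ |τ| * |Q - B - τ / 2| := by
          rw [← abs_mul]; exact le_abs_self _
      _ ≤ _ := mul_le_mul hτ hW (abs_nonneg _) (by positivity)
  have key2 : δ ^ 3 / 100 * (1.2 * R) ≤ δ ^ 2 / 100 * (2.4 * s) := by
    have : δ * R ≤ 2 * s := by nlinarith
    calc δ ^ 3 / 100 * (1.2 * R) = δ ^ 2 / 100 * 1.2 * (δ * R) := by ring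
      _ ≤ δ ^ 2 / 100 * 1.2 * (2 * s) := by gcongr
      _ = _ := by ring
  -- Here A - 1 + r / 2 ≥ -0.375 δ², and δ² ≤ 2s leaves at least s / 4.
  have key3 : 0.15 * δ ^ 2 * (0.25 * s) ≤ r * (s - 1 + A + r / 2) := by
    apply mul_le_mul h5 _ (by nlinarith) (by linarith)
    linarith
  nlinarith

lemma not_emptyCap_of_mem (hδ : 0 < δ) (h : (w₁, w₂) ∈ successSet b δ) {G : Finset Plane}
    (hG : w₁ ∈ G) : ¬ EmptyCap b δ G := fun h' =>
  absurd (h' _ hG) (first_mem_cap_of_mem_successSet hδ h).not_ge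

end Success

/-! ### Bisectors that cut off small caps -/

/-- A pair whose bisector has normal `u` close to `b 0` and cuts off a cap of height at most
`4 * δ ^ 2` lies in `bisectorSet b δ`. -/
lemma mem_bisectorSet {b : PlaneBasis} {δ : ℝ} (hδ : 0 < δ) {w₁ w₂ u : Plane}
    {D : ℝ} (hw₂ : w₂ ∈ unitBall) (hu : ‖u‖ = 1) (hD : 0 ≤ D)
    (hw : w₂ - w₁ = D • u) (hub : ‖u - b 0‖ ≤ δ / 4)
    (hq : 1 - 4 * δ ^ 2 ≤ inner ℝ w₂ u - D / 2) :
    (w₁, w₂) ∈ bisectorSet b δ := by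
  rw [mem_unitBall_iff] at hw₂
  have hb (i) : ‖b i‖ = 1 := b.norm_eq_one i
  have h01 : inner ℝ (b 1) (b 0) = 0 := b.inner_eq_zero (by decide)
  have hwu : inner ℝ w₂ u ≤ 1 := by
    have := real_inner_le_norm w₂ u
    rw [hu] at this; linarith
  have hsq : ‖w₂ - u‖ ^ 2 ≤ (3 * δ) ^ 2 := by
    rw [norm_sub_sq_real, hu]
    nlinarith [norm_nonneg w₂]
  have hn : ‖w₂ - u‖ ≤ 3 * δ := (sq_le_sq₀ (norm_nonneg _) (by positivity)).1 hsq
  have hwb : ‖w₂ - b 0‖ ≤ 4 * δ := by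
    have := norm_sub_le_norm_sub_add_norm_sub w₂ u (b 0)
    linarith
  have e1 : inner ℝ (b 1) w₂ = inner ℝ (b 1) (w₂ - b 0) := by rw [inner_sub_right, h01, sub_zero]
  have e2 : inner ℝ (b 1) u = inner ℝ (b 1) (u - b 0) := by rw [inner_sub_right, h01, sub_zero]
  have i1 : |inner ℝ (b 1) w₂| ≤ 4 * δ := by
    rw [e1]
    have := abs_real_inner_le_norm (b 1) (w₂ - b 0)
    rw [hb] at this; linarith
  have i2 : |inner ℝ (b 1) u| ≤ δ / 4 := by
    rw [e2]
    have := abs_real_inner_le_norm (b 1) (u - b 0)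
    rw [hb] at this; linarith
  have i3 : |inner ℝ (b 0) u| ≤ 1 := by
    have := abs_real_inner_le_norm (b 0) u
    rwa [hb, hu, one_mul] at this
  have i4 : inner ℝ (b 0) w₂ ≤ 1 := by
    have := real_inner_le_norm (b 0) w₂
    rw [hb] at this; linarith
  have i5 : |inner ℝ (w₂ - u) (u - b 0)| ≤ 3 * δ * (δ / 4) :=
    (abs_real_inner_le_norm _ _).trans (mul_le_mul hn hub (norm_nonneg _) (by positivity))
  have i6 : ‖u - b 0‖ ^ 2 ≤ (δ / 4) ^ 2 := by gcongr
  have hDb : D ≤ 8 * δ ^ 2 := by linarith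
  have e3 : w₁ - w₂ = -(D • u) := by rw [← hw]; abel
  -- For unit vectors, replacing `u` by `b 0` costs only products of two O(δ) quantities, which is
  -- the order of the cap height.
  have e4 : inner ℝ (b 0) w₂ = inner ℝ w₂ u - inner ℝ (w₂ - u) (u - b 0) - ‖u - b 0‖ ^ 2 / 2 := by
    rw [norm_sub_sq_real, hu, hb]
    simp only [inner_sub_left, inner_sub_right, real_inner_self_eq_norm_sq, hu,
      real_inner_comm w₂ (b 0)]
    ring
  rw [abs_le] at i1 i5
  have h0 : |D * inner ℝ (b 0) u| ≤ 8 * δ ^ 2 := by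
    rw [abs_mul, abs_of_nonneg hD]
    nlinarith [abs_nonneg (inner ℝ (b 0) u)]
  have h1 : |D * inner ℝ (b 1) u| ≤ 2 * δ ^ 3 := by
    rw [abs_mul, abs_of_nonneg hD]
    calc D * |inner ℝ (b 1) u| ≤ 8 * δ ^ 2 * (δ / 4) := by gcongr
      _ = _ := by ring
  rw [abs_le] at h0 h1
  refine ⟨⟨⟨?_, i4⟩, i1⟩, ?_⟩
  · dsimp only; nlinarith
  · dsimp only
    rw [e3]
    simp only [rectangle, Set.mem_ofPred_eq, inner_neg_right, inner_smul_right, Set.mem_Icc]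
    refine ⟨⟨?_, ?_⟩, ?_, ?_⟩ <;> linarith [h0.1, h0.2, h1.1, h1.2]

/-- A member who prefers `w₁` lies on its side of the bisector. -/
lemma inner_le_of_dist_le {w₁ w₂ u v : Plane} {D : ℝ} (hu : ‖u‖ = 1) (hD : 0 < D)
    (hw : w₂ - w₁ = D • u) (h : dist v w₁ ≤ dist v w₂) :
    inner ℝ v u ≤ inner ℝ w₂ u - D / 2 := by
  obtain rfl : w₁ = w₂ - D • u := by rw [← hw]; abel
  have e : v - (w₂ - D • u) = (v - w₂) + D • u := by abel
  rw [dist_eq_norm, dist_eq_norm, ← sq_le_sq₀ (norm_nonneg _) (norm_nonneg _), e,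
    norm_add_sq_real, norm_smul, hu, inner_smul_right, inner_sub_left, Real.norm_eq_abs,
    mul_one, sq_abs] at h
  have : D * (2 * (inner ℝ v u - inner ℝ w₂ u) + D) ≤ 0 := by nlinarith
  have := nonpos_of_mul_nonpos_right this hD
  linarith

/-- A point of depth s in direction `u` is within R = √(2s) of `u`, so the tilt reduces the depth by
at most Rδ/4 ≤ R²/4 = s/2. -/
lemma inner_le_of_near {b : PlaneBasis} {δ : ℝ} {u v : Plane} (hv : v ∈ unitBall)
    (hu : ‖u‖ = 1) (hub : ‖u - b 0‖ ≤ δ / 4) (h : inner ℝ v u ≤ 1 - δ ^ 2) :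
    inner ℝ (b 0) v ≤ 1 - δ ^ 2 / 2 := by
  rw [mem_unitBall_iff] at hv
  have hb (i) : ‖b i‖ = 1 := b.norm_eq_one i
  obtain ⟨s, hs⟩ : ∃ s, inner ℝ v u = 1 - s := ⟨1 - inner ℝ v u, by ring⟩
  set R := √(2 * s) with hR
  have hR2 : R ^ 2 = 2 * s := Real.sq_sqrt (by nlinarith)
  have hR0 : 0 ≤ R := Real.sqrt_nonneg _
  have hδR : δ ≤ R := Real.le_sqrt_of_sq_le (by nlinarith)
  have hn : ‖v - u‖ ≤ R := by
    apply (sq_le_sq₀ (norm_nonneg _) hR0).1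
    rw [norm_sub_sq_real, hu, hs, hR2]
    nlinarith [norm_nonneg v]
  have i5 : |inner ℝ (v - u) (u - b 0)| ≤ R * (δ / 4) :=
    (abs_real_inner_le_norm _ _).trans (mul_le_mul hn hub (norm_nonneg _) hR0)
  have e4 : inner ℝ (b 0) v = inner ℝ v u - inner ℝ (v - u) (u - b 0) - ‖u - b 0‖ ^ 2 / 2 := by
    rw [norm_sub_sq_real, hu, hb]
    simp only [inner_sub_left, inner_sub_right, real_inner_self_eq_norm_sq, hu,
      real_inner_comm v (b 0)]
    ring
  rw [abs_le] at i5
  rw [e4, hs]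
  nlinarith [sq_nonneg ‖u - b 0‖]

/-! ### Directions -/

/-- The unit vector with polar angle `θ`. -/
noncomputable def angleVec (θ : ℝ) : Plane := !₂[Real.cos θ, Real.sin θ]

lemma inner_angleVec (θ φ : ℝ) : inner ℝ (angleVec θ) (angleVec φ) = Real.cos (θ - φ) := by
  simp [angleVec, PiLp.inner_apply, Fin.sum_univ_two, Real.cos_sub]
  ring

lemma norm_angleVec (θ : ℝ) : ‖angleVec θ‖ = 1 := by
  rw [← sq_eq_sq₀ (norm_nonneg _) zero_le_one, ← real_inner_self_eq_norm_sq, inner_angleVec]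
  simp

lemma exists_planeBasis (θ : ℝ) : ∃ b : PlaneBasis, b 0 = angleVec θ := by
  obtain ⟨b, hb⟩ := Orthonormal.exists_orthonormalBasis_extension_of_card_eq (𝕜 := ℝ)
    (E := Plane) (ι := Fin 2) (by simp) (v := fun _ => angleVec θ) (s := {0})
    (by
      rw [orthonormal_iff_ite]
      rintro ⟨i, hi⟩ ⟨j, hj⟩
      obtain rfl : i = 0 := hi
      obtain rfl : j = 0 := hj
      simp [norm_angleVec])
  exact ⟨b, hb 0 rfl⟩

/-- An orthonormal basis of the plane with first vector of polar angle `θ`. -/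
noncomputable def angleBasis (θ : ℝ) : PlaneBasis := (exists_planeBasis θ).choose

lemma angleBasis_zero (θ : ℝ) : angleBasis θ 0 = angleVec θ := (exists_planeBasis θ).choose_spec

lemma norm_angleVec_sub_sq (θ φ : ℝ) :
    ‖angleVec θ - angleVec φ‖ ^ 2 = 2 - 2 * Real.cos (θ - φ) := by
  rw [norm_sub_sq_real, norm_angleVec, norm_angleVec, inner_angleVec]; ring

lemma norm_angleVec_sub_le (θ φ : ℝ) : ‖angleVec θ - angleVec φ‖ ≤ |θ - φ| := by
  rw [← sq_le_sq₀ (norm_nonneg _) (abs_nonneg _), norm_angleVec_sub_sq, sq_abs]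
  linarith [Real.one_sub_sq_div_two_le_cos (x := θ - φ)]

lemma exists_angleVec_eq {u : Plane} (hu : ‖u‖ = 1) :
    ∃ θ, 0 ≤ θ ∧ θ < 2 * Real.pi ∧ u = angleVec θ := by
  have h1 : u 0 ^ 2 + u 1 ^ 2 = 1 := by
    have := EuclideanSpace.real_norm_sq_eq u
    rw [hu, Fin.sum_univ_two] at this
    linarith
  set z : ℂ := ⟨u 0, u 1⟩ with hz
  have hzn : ‖z‖ = 1 := by
    rw [Complex.norm_def, Complex.normSq_apply, hz]
    simp only
    rw [← sq, ← sq, h1, Real.sqrt_one]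
  have hz0 : z ≠ 0 := by
    intro h; simp [h] at hzn
  have hc : Real.cos z.arg = u 0 := by rw [Complex.cos_arg hz0, hzn, div_one]
  have hs : Real.sin z.arg = u 1 := by rw [Complex.sin_arg, hzn, div_one]
  have key : ∀ θ, Real.cos θ = u 0 → Real.sin θ = u 1 → u = angleVec θ := by
    intro θ hc hs
    ext i
    fin_cases i <;> simp [angleVec, hc, hs]
  have hp := Real.pi_pos
  have ha := Complex.neg_pi_lt_arg z
  have ha' := Complex.arg_le_pi z
  rcases le_or_gt 0 z.arg with h | h
  · exact ⟨z.arg, h, by linarith, key _ hc hs⟩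
  · exact ⟨z.arg + 2 * Real.pi, by linarith, by linarith,
      key _ (by rw [Real.cos_add_two_pi, hc]) (by rw [Real.sin_add_two_pi, hs])⟩

/-- The directions `k * 2 ^ (-m) / 4`, for `k < 26 * 2 ^ m`, form a net of the circle. -/
noncomputable def netBasis (m k : ℕ) : PlaneBasis := angleBasis (k * ((1 / 2) ^ m / 4))

lemma exists_netBasis_near {u : Plane} (hu : ‖u‖ = 1) (m : ℕ) :
    ∃ k < 26 * 2 ^ m, ‖u - netBasis m k 0‖ ≤ (1 / 2 : ℝ) ^ m / 4 := by
  obtain ⟨θ, h0, h1, rfl⟩ := exists_angleVec_eq hu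
  set ε : ℝ := (1 / 2 : ℝ) ^ m / 4 with hε
  have hεp : 0 < ε := by positivity
  refine ⟨⌊θ / ε⌋₊, ?_, ?_⟩
  · rw [Nat.floor_lt (by positivity), div_lt_iff₀ hεp]
    -- The factor 26 is 4 · 6.5, and 6.5 > 2π, so the net goes once around the circle.
    have : ((26 * 2 ^ m : ℕ) : ℝ) * ε = 6.5 := by
      rw [hε]; push_cast
      rw [one_div, inv_pow]
      field_simp
      norm_num
    rw [this]
    linarith [Real.pi_lt_d2]
  · rw [netBasis, angleBasis_zero, ← hε]
    refine (norm_angleVec_sub_le _ _).trans ?_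
    have l1 := Nat.floor_le (a := θ / ε) (by positivity)
    have l2 := Nat.lt_floor_add_one (θ / ε)
    rw [le_div_iff₀ hεp] at l1
    rw [div_lt_iff₀ hεp] at l2
    rw [abs_le]
    constructor <;> nlinarith

/-- The caps of height `(4 * n) ^ (-2) / 2` at the angles `i / n`, for `i < n`, are disjoint. -/
lemma caps_disjoint {n i j : ℕ} (hi : i < n) (hj : j < n) {v : Plane} (hv : v ∈ unitBall)
    (h1 : 1 - (1 / (4 * n) : ℝ) ^ 2 / 2 < inner ℝ (angleBasis (i / n) 0) v)
    (h2 : 1 - (1 / (4 * n) : ℝ) ^ 2 / 2 < inner ℝ (angleBasis (j / n) 0) v) : i = j := by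
  rw [mem_unitBall_iff] at hv
  rw [angleBasis_zero] at h1 h2
  have hn : (0 : ℝ) < n := by exact_mod_cast (Nat.zero_le i).trans_lt hi
  set δ : ℝ := 1 / (4 * n) with hδ
  have hδ0 : 0 < δ := by positivity
  -- A point of a cap is within δ of its centre, so two caps that meet have centres at distance at
  -- most 2δ = 1/(2n).
  have key (θ : ℝ) (h : 1 - δ ^ 2 / 2 < inner ℝ (angleVec θ) v) : ‖angleVec θ - v‖ ≤ δ := by
    rw [← sq_le_sq₀ (norm_nonneg _) hδ0.le, norm_sub_sq_real, norm_angleVec]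
    nlinarith [norm_nonneg v]
  have hd : ‖angleVec (i / n) - angleVec (j / n)‖ ≤ 2 * δ := by
    have := norm_sub_le_norm_sub_add_norm_sub (angleVec (i / n)) v (angleVec (j / n))
    have k1 := key _ h1
    have k2 := key _ h2
    rw [norm_sub_rev] at k2
    linarith
  have hsq : ‖angleVec (i / n) - angleVec (j / n)‖ ^ 2 ≤ (2 * δ) ^ 2 := by gcongr
  rw [norm_angleVec_sub_sq] at hsq
  set x : ℝ := i / n - j / n with hx
  have hxn : x * n = i - j := by rw [hx]; field_simp
  have hi' : (i : ℝ) < n := by exact_mod_cast hi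
  have hj' : (j : ℝ) < n := by exact_mod_cast hj
  -- The angles stay in [0, 1), so there is no wrap-around and the chord is comparable to the angle.
  have hx1 : |x| ≤ 1 := by
    rw [abs_le]
    have hi0 : (0 : ℝ) ≤ i := i.cast_nonneg
    have hj0 : (0 : ℝ) ≤ j := j.cast_nonneg
    constructor <;> nlinarith
  have hcos := Real.cos_le_one_sub_mul_cos_sq (x := x) (by linarith [Real.pi_gt_three])
  have hπ : (0.2 : ℝ) ≤ 2 / Real.pi ^ 2 := by
    rw [le_div_iff₀ (by positivity)]
    nlinarith [Real.pi_lt_d2, Real.pi_pos]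
  have hc2 : 0.2 * x ^ 2 ≤ 2 / Real.pi ^ 2 * x ^ 2 := by gcongr
  have hx2 : 0.4 * x ^ 2 ≤ (2 * δ) ^ 2 := by linarith
  have hδn : δ * n = 1 / 4 := by rw [hδ]; field_simp
  have hfin : 0.4 * ((i : ℝ) - j) ^ 2 ≤ 1 / 4 := by
    rw [← hxn]
    calc 0.4 * (x * n) ^ 2 = 0.4 * x ^ 2 * n ^ 2 := by ring
      _ ≤ (2 * δ) ^ 2 * n ^ 2 := by gcongr
      _ = 4 * (δ * n) ^ 2 := by ring
      _ = 1 / 4 := by rw [hδn]; norm_num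
  by_contra hne
  have h1 : (1 : ℝ) ≤ ((i : ℝ) - j) ^ 2 := by
    have : (1 : ℤ) ≤ ((i : ℤ) - j) ^ 2 := by
      have : (i : ℤ) - j ≠ 0 := by omega
      have := sq_pos_of_ne_zero this
      omega
    exact_mod_cast this
  linarith

/-! ### Accepted pairs sorted by dyadic cap height -/

/-- A pair of candidates of which the first is preferred by all of `G` lies in one of finitely many
bisector sets. -/
lemma exists_bisectorSet {G : Finset Plane} (hG : ∀ v ∈ G, v ∈ unitBall) {w₁ w₂ : Plane}
    (hne : w₁ ≠ w₂) (hw₁ : w₁ ∈ unitBall) (hw₂ : w₂ ∈ unitBall)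
    (h : ∀ v ∈ G, dist v w₁ ≤ dist v w₂) (J : ℕ) :
    (∃ k < 26 * 2 ^ J, (w₁, w₂) ∈ bisectorSet (netBasis J k) ((1 / 2) ^ J)) ∨
    ∃ m < J, ∃ k < 26 * 2 ^ m, (w₁, w₂) ∈ bisectorSet (netBasis m k) ((1 / 2) ^ m) ∧
      EmptyCap (netBasis m k) ((1 / 2) ^ m) G := by
  set D := ‖w₂ - w₁‖ with hD
  have hDp : 0 < D := norm_pos_iff.2 (sub_ne_zero.2 hne.symm)
  set u := D⁻¹ • (w₂ - w₁) with hu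
  have hun : ‖u‖ = 1 := by
    rw [hu, norm_smul, ← hD, norm_inv, Real.norm_of_nonneg hDp.le, inv_mul_cancel₀ hDp.ne']
  have hw : w₂ - w₁ = D • u := by rw [hu, smul_inv_smul₀ hDp.ne']
  -- The height of the cap that the bisector cuts off on the side of `w₂`.
  set q := 1 - (inner ℝ w₂ u - D / 2) with hq
  have hq2 : q ≤ 4 := by
    rw [mem_unitBall_iff] at hw₁ hw₂
    have h1 := abs_real_inner_le_norm w₂ u
    have h2 := abs_real_inner_le_norm w₁ u
    have h3 : inner ℝ w₂ u - inner ℝ w₁ u = D := by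
      rw [← inner_sub_left, hw, real_inner_smul_left, real_inner_self_eq_norm_sq, hun]; ring
    rw [hun, mul_one] at h1 h2
    linarith [abs_le.1 h1, abs_le.1 h2, (abs_le.1 h1).1, (abs_le.1 h2).1]
  -- Heights are sorted into the ranges [δ², 4δ²] with δ = 2^(-m); all heights at most 4 · 4^(-J)
  -- are kept together.
  have key : ∀ J : ℕ, q ≤ 4 * ((1 / 2 : ℝ) ^ J) ^ 2 ∨
      ∃ m < J, ((1 / 2 : ℝ) ^ m) ^ 2 ≤ q ∧ q ≤ 4 * ((1 / 2 : ℝ) ^ m) ^ 2 := by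
    intro J
    induction J with
    | zero => left; simpa using hq2
    | succ J ih =>
      rcases ih with ih | ⟨m, hm, h⟩
      · rcases le_or_gt q (((1 / 2 : ℝ) ^ J) ^ 2) with h | h
        · left; rw [pow_succ (1 / 2 : ℝ) J, mul_pow]; linarith
        · exact Or.inr ⟨J, Nat.lt_succ_self J, h.le, ih⟩
      · exact Or.inr ⟨m, by omega, h⟩
  rcases key J with h1 | ⟨m, hm, h1, h2⟩
  · left
    obtain ⟨k, hk, hk'⟩ := exists_netBasis_near hun J
    exact ⟨k, hk, mem_bisectorSet (by positivity) hw₂ hun hDp.le hw hk' (by linarith)⟩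
  · right
    obtain ⟨k, hk, hk'⟩ := exists_netBasis_near hun m
    refine ⟨m, hm, k, hk, mem_bisectorSet (by positivity) hw₂ hun hDp.le hw hk' (by linarith), ?_⟩
    intro v hv
    refine inner_le_of_near (hG v hv) hun hk' ?_
    linarith [inner_le_of_dist_le hun hDp hw (h v hv)]

/-! ### The random group -/

section Group

variable {Ω : Type*} {k : ℕ} {v : Fin k → Ω → Plane} {w : ℕ → Fin 2 → Ω → Plane}

/-- The event that candidate `j` of round `t + 1` is accepted. -/
def acceptance (v : Fin k → Ω → Plane) (w : ℕ → Fin 2 → Ω → Plane) (t : ℕ) (j : Fin 2) : Set Ω :=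
  {ω | IsAccepted (randomGroup v w t ω) {w t 0 ω, w t 1 ω} (w t j ω)}

lemma mem_acceptance_iff {t : ℕ} {j : Fin 2} {ω : Ω} : ω ∈ acceptance v w t j ↔
    ∀ x ∈ randomGroup v w t ω, ∀ l, dist x (w t j ω) ≤ dist x (w t l ω) := by
  have hj : w t j ω = w t 0 ω ∨ w t j ω = w t 1 ω := by
    fin_cases j <;> simp
  simp only [acceptance, Set.mem_ofPred_eq, IsAccepted, VotesFor, Fin.forall_fin_two,
    Finset.mem_insert, Finset.mem_singleton, forall_eq_or_imp, forall_eq, hj, true_and]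

open Classical in
lemma randomGroup_succ (t : ℕ) (ω : Ω) : randomGroup v w (t + 1) ω = randomGroup v w t ω ∪
    (Finset.univ.filter fun j => ω ∈ acceptance v w t j).image fun j => w t j ω := by
  ext x
  simp only [Finset.mem_union, Finset.mem_filter, Finset.mem_image, Finset.mem_univ, true_and,
    Fin.exists_fin_two]
  simp only [randomGroup, socialGroup, acceptance, Finset.mem_union, Finset.mem_filter,
    Finset.mem_insert, Finset.mem_singleton, Set.mem_ofPred_eq]
  refine or_congr_right ⟨?_, ?_⟩
  · rintro ⟨rfl | rfl, h⟩
    · exact Or.inl ⟨h, rfl⟩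
    · exact Or.inr ⟨h, rfl⟩
  · rintro (⟨h, rfl⟩ | ⟨h, rfl⟩)
    · exact ⟨Or.inl rfl, h⟩
    · exact ⟨Or.inr rfl, h⟩

lemma mem_randomGroup_zero {ω : Ω} {x : Plane} :
    x ∈ randomGroup v w 0 ω ↔ ∃ i, v i ω = x := by
  simp [randomGroup, socialGroup]

lemma mem_randomGroup_succ {t : ℕ} {ω : Ω} {x : Plane} : x ∈ randomGroup v w (t + 1) ω ↔
    x ∈ randomGroup v w t ω ∨ ∃ j, ω ∈ acceptance v w t j ∧ w t j ω = x := by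
  classical
  rw [randomGroup_succ]
  simp

lemma mem_randomGroup_iff {t : ℕ} {ω : Ω} {x : Plane} : x ∈ randomGroup v w t ω ↔
    (∃ i, v i ω = x) ∨ ∃ s < t, ∃ j, ω ∈ acceptance v w s j ∧ w s j ω = x := by
  induction t with
  | zero => simp [mem_randomGroup_zero]
  | succ t ih =>
    simp only [mem_randomGroup_succ, ih, Nat.lt_succ_iff_lt_or_eq, or_and_right, exists_or,
      exists_eq_left, or_assoc]

lemma randomGroup_mono (ω : Ω) : Monotone fun t => randomGroup v w t ω :=
  monotone_nat_of_le_succ fun _ _ hx => mem_randomGroup_succ.2 (Or.inl hx)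

/-- Membership unrolls into finitely many acceptance events. Only rounds before `t` enter, so the
σ-algebra on `Ω` may later be the one generated by the past. -/
lemma measurableSet_forall_mem_randomGroup [MeasurableSpace Ω] {t : ℕ}
    (hv : ∀ i, Measurable (v i)) (hw : ∀ s < t, ∀ j, Measurable (w s j))
    (ha : ∀ s < t, ∀ j, MeasurableSet (acceptance v w s j)) {Q : Ω → Plane → Prop}
    (hQ : ∀ f : Ω → Plane, Measurable f → MeasurableSet {ω | Q ω (f ω)}) :
    MeasurableSet {ω | ∀ x ∈ randomGroup v w t ω, Q ω x} := by
  have e : {ω | ∀ x ∈ randomGroup v w t ω, Q ω x} = (⋂ i, {ω | Q ω (v i ω)}) ∩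
      ⋂ s, ⋂ (_ : s < t), ⋂ j, (acceptance v w s j)ᶜ ∪ {ω | Q ω (w s j ω)} := by
    ext ω
    simp only [mem_randomGroup_iff, Set.mem_ofPred_eq, Set.mem_inter_iff, Set.mem_iInter,
      Set.mem_union, Set.mem_compl_iff]
    constructor
    · intro h
      refine ⟨fun i => h _ (Or.inl ⟨i, rfl⟩), fun s hs j => ?_⟩
      by_cases hj : ω ∈ acceptance v w s j
      · exact Or.inr (h _ (Or.inr ⟨s, hs, j, hj, rfl⟩))
      · exact Or.inl hj
    · rintro ⟨h1, h2⟩ x (⟨i, rfl⟩ | ⟨s, hs, j, hj, rfl⟩)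
      · exact h1 i
      · exact (h2 s hs j).resolve_left (not_not.2 hj)
  rw [e]
  exact (MeasurableSet.iInter fun i => hQ _ (hv i)).inter <| MeasurableSet.iInter fun s =>
    MeasurableSet.iInter fun hs => MeasurableSet.iInter fun j =>
      (ha s hs j).compl.union (hQ _ (hw s hs j))

lemma measurableSet_acceptance [MeasurableSpace Ω] (hv : ∀ i, Measurable (v i)) (t : ℕ)
    (hw : ∀ s ≤ t, ∀ j, Measurable (w s j)) (j : Fin 2) :
    MeasurableSet (acceptance v w t j) := by
  induction t using Nat.strong_induction_on generalizing j with
  | _ t ih =>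
    have e : acceptance v w t j = {ω | ∀ x ∈ randomGroup v w t ω,
        ∀ l, dist x (w t j ω) ≤ dist x (w t l ω)} := by
      ext ω; exact mem_acceptance_iff
    rw [e]
    refine measurableSet_forall_mem_randomGroup hv (fun s hs => hw s hs.le)
      (fun s hs j => ih s hs (fun r hr => hw r (hr.trans hs.le)) j) fun f hf => ?_
    have : {ω | ∀ l, dist (f ω) (w t j ω) ≤ dist (f ω) (w t l ω)} =
        ⋂ l, {ω | dist (f ω) (w t j ω) ≤ dist (f ω) (w t l ω)} := by ext; simp
    rw [this]
    exact MeasurableSet.iInter fun l =>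
      measurableSet_le (hf.dist (hw t le_rfl j)) (hf.dist (hw t le_rfl l))

/-- The event that the cap of `EmptyCap b δ` is empty after `t` rounds. -/
def emptyCapEvent (v : Fin k → Ω → Plane) (w : ℕ → Fin 2 → Ω → Plane) (b : PlaneBasis) (δ : ℝ)
    (t : ℕ) : Set Ω :=
  {ω | EmptyCap b δ (randomGroup v w t ω)}

lemma measurableSet_emptyCapEvent [MeasurableSpace Ω] (hv : ∀ i, Measurable (v i)) {t : ℕ}
    (hw : ∀ s < t, ∀ j, Measurable (w s j)) (b : PlaneBasis) (δ : ℝ) :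
    MeasurableSet (emptyCapEvent v w b δ t) :=
  measurableSet_forall_mem_randomGroup hv hw
    (fun s hs => measurableSet_acceptance hv s fun r hr => hw r (hr.trans_lt hs))
    fun f hf => measurableSet_le (by fun_prop) measurable_const

/-- The locations of all initial members and all candidates. -/
def location (v : Fin k → Ω → Plane) (w : ℕ → Fin 2 → Ω → Plane) :
    Fin k ⊕ (ℕ × Fin 2) → Ω → Plane :=
  Sum.elim v fun p => w p.1 p.2

/-- The locations at `ω` are distinct points of the disk. -/
structure IsGeneric (v : Fin k → Ω → Plane) (w : ℕ → Fin 2 → Ω → Plane) (ω : Ω) : Prop where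
  mem : ∀ a, location v w a ω ∈ unitBall
  inj : Function.Injective fun a => location v w a ω

namespace IsGeneric

variable {ω : Ω}

lemma mem_candidate (h : IsGeneric v w ω) (t : ℕ) (j : Fin 2) : w t j ω ∈ unitBall :=
  h.mem (Sum.inr (t, j))

lemma candidate_injective (h : IsGeneric v w ω) {s t : ℕ} {i j : Fin 2}
    (e : w s i ω = w t j ω) : s = t ∧ i = j := by
  have := h.inj (a₁ := Sum.inr (s, i)) (a₂ := Sum.inr (t, j)) e
  simpa using this

/-- In `Fin 2`, `j + 1` is the other candidate. -/
lemma candidate_ne (h : IsGeneric v w ω) (t : ℕ) (j : Fin 2) : w t j ω ≠ w t (j + 1) ω := by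
  intro e
  have := (h.candidate_injective e).2
  revert this
  fin_cases j <;> decide

lemma mem_group (h : IsGeneric v w ω) {t : ℕ} {x : Plane} (hx : x ∈ randomGroup v w t ω) :
    x ∈ unitBall := by
  rcases mem_randomGroup_iff.1 hx with ⟨i, rfl⟩ | ⟨s, -, j, -, rfl⟩
  · exact h.mem (Sum.inl i)
  · exact h.mem_candidate s j

lemma candidate_notMem (h : IsGeneric v w ω) (t : ℕ) (j : Fin 2) :
    w t j ω ∉ randomGroup v w t ω := by
  intro hx
  rcases mem_randomGroup_iff.1 hx with ⟨i, hi⟩ | ⟨s, hs, l, -, hl⟩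
  · have := h.inj (a₁ := Sum.inl i) (a₂ := Sum.inr (t, j)) hi
    simp at this
  · exact hs.ne (h.candidate_injective hl).1

lemma card_randomGroup (h : IsGeneric v w ω) (t : ℕ) :
    ((randomGroup v w t ω).card : ℝ) =
      k + ∑ s ∈ Finset.range t, ∑ j, (acceptance v w s j).indicator 1 ω := by
  classical
  induction t with
  | zero =>
    have : Function.Injective fun i => v i ω := fun i j e => by
      simpa using h.inj (a₁ := Sum.inl i) (a₂ := Sum.inl j) e
    simp [randomGroup, socialGroup, Finset.card_image_of_injective _ this]
  | succ t ih =>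
    rw [randomGroup_succ, Finset.card_union_of_disjoint, Finset.card_image_of_injective,
      Nat.cast_add, ih, Finset.sum_range_succ, add_assoc, Finset.card_filter]
    · simp [Set.indicator_apply]
    · exact fun i j e => (h.candidate_injective e).2
    · rw [Finset.disjoint_right]
      intro x hx
      obtain ⟨j, -, rfl⟩ := Finset.mem_image.1 hx
      exact h.candidate_notMem t j

lemma mem_acceptance_of_mem_successSet (h : IsGeneric v w ω) {t : ℕ} {b : PlaneBasis} {δ : ℝ}
    (hδ : 0 < δ) (hδ1 : δ ≤ 1) (hE : ω ∈ emptyCapEvent v w b δ t)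
    (hS : (w t 0 ω, w t 1 ω) ∈ successSet b δ) : ω ∈ acceptance v w t 0 := by
  rw [mem_acceptance_iff]
  intro x hx l
  fin_cases l
  · exact le_rfl
  · exact dist_le_dist_of_mem_successSet hδ hδ1 hS (h.mem_group hx) (hE x hx)

/-- A success puts an accepted candidate into the cap, and members never leave. -/
lemma notMem_emptyCapEvent (h : IsGeneric v w ω) {s t : ℕ} (hst : s < t) {b : PlaneBasis} {δ : ℝ}
    (hδ : 0 < δ) (hδ1 : δ ≤ 1) (hE : ω ∈ emptyCapEvent v w b δ s)
    (hS : (w s 0 ω, w s 1 ω) ∈ successSet b δ) : ω ∉ emptyCapEvent v w b δ t :=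
  not_emptyCap_of_mem hδ hS <| randomGroup_mono ω (Nat.succ_le_of_lt hst) <|
    mem_randomGroup_succ.2 <| Or.inr ⟨0, h.mem_acceptance_of_mem_successSet hδ hδ1 hE hS, rfl⟩

lemma exists_bisectorSet_of_mem_acceptance (h : IsGeneric v w ω) {t : ℕ} {j : Fin 2}
    (ha : ω ∈ acceptance v w t j) (J : ℕ) :
    (∃ i < 26 * 2 ^ J, (w t j ω, w t (j + 1) ω) ∈ bisectorSet (netBasis J i) ((1 / 2) ^ J)) ∨
    ∃ m < J, ∃ i < 26 * 2 ^ m,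
      (w t j ω, w t (j + 1) ω) ∈ bisectorSet (netBasis m i) ((1 / 2) ^ m) ∧
      ω ∈ emptyCapEvent v w (netBasis m i) ((1 / 2) ^ m) t :=
  exists_bisectorSet (fun _ => h.mem_group) (h.candidate_ne t j) (h.mem_candidate t j)
    (h.mem_candidate t _) (fun x hx => mem_acceptance_iff.1 ha x hx _) J

/-- Disjoint caps contain distinct members, so at most `|G|` caps are occupied. -/
lemma sum_indicator_compl_emptyCapEvent_le (h : IsGeneric v w ω) (n t : ℕ) :
    ∑ i ∈ Finset.range n,
      (emptyCapEvent v w (angleBasis (i / n)) (1 / (4 * n)) t)ᶜ.indicator (1 : Ω → ℝ) ω ≤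
      (randomGroup v w t ω).card := by
  classical
  simp only [Set.indicator_apply, Pi.one_apply, Finset.sum_boole]
  refine Nat.cast_le.2 ?_
  have hex (i : ℕ) (hi : i ∈ (Finset.range n).filter fun i : ℕ =>
      ω ∈ (emptyCapEvent v w (angleBasis (i / n)) (1 / (4 * n)) t)ᶜ) :
      ∃ x ∈ randomGroup v w t ω, 1 - (1 / (4 * n) : ℝ) ^ 2 / 2 <
        inner ℝ (angleBasis (i / n) 0) x := by
    have := (Finset.mem_filter.1 hi).2
    simpa [emptyCapEvent, EmptyCap] using this
  choose f hf hf' using hex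
  refine Finset.card_le_card_of_injOn (fun i => if hi : i ∈ _ then f i hi else 0) ?_ ?_
  · intro i hi
    simp only [Finset.mem_coe] at hi
    simp only [hi, dif_pos]
    exact hf i hi
  · intro i hi j hj e
    simp only [Finset.mem_coe] at hi hj
    simp only [hi, hj, dif_pos] at e
    have h2 := hf' j hj
    rw [← e] at h2
    exact caps_disjoint (Finset.mem_range.1 (Finset.mem_filter.1 hi).1)
      (Finset.mem_range.1 (Finset.mem_filter.1 hj).1) (h.mem_group (hf i hi)) (hf' i hi) h2

end IsGeneric

end Group

/-! ### Uniform independent locations -/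

lemma measurableSet_unitBall : MeasurableSet unitBall := measurableSet_closedBall

lemma volume_unitBall : volume unitBall = ENNReal.ofReal Real.pi := by
  rw [unitBall, EuclideanSpace.volume_closedBall_fin_two]
  simp

/-- The initial members and the candidates are independent and uniformly distributed on the disk. -/
structure IsUniformModel {Ω : Type*} [MeasurableSpace Ω] (P : Measure Ω) {k : ℕ}
    (v : Fin k → Ω → Plane) (w : ℕ → Fin 2 → Ω → Plane) : Prop where
  measurable : ∀ a, Measurable (location v w a)
  uniform : ∀ a, pdf.IsUniform (location v w a) unitBall P volume
  indep : iIndepFun (location v w) P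

namespace IsUniformModel

variable {Ω : Type*} [MeasurableSpace Ω] {P : Measure Ω} {k : ℕ}
  {v : Fin k → Ω → Plane} {w : ℕ → Fin 2 → Ω → Plane}

lemma measurable_member (h : IsUniformModel P v w) (i : Fin k) : Measurable (v i) :=
  h.measurable (Sum.inl i)

lemma measurable_candidate (h : IsUniformModel P v w) (t : ℕ) (j : Fin 2) : Measurable (w t j) :=
  h.measurable (Sum.inr (t, j))

lemma measurable_pair (h : IsUniformModel P v w) (t : ℕ) (i j : Fin 2) :
    Measurable fun ω => (w t i ω, w t j ω) :=
  (h.measurable_candidate t i).prodMk (h.measurable_candidate t j)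

lemma measurableSet_acceptance (h : IsUniformModel P v w) (t : ℕ) (j : Fin 2) :
    MeasurableSet (acceptance v w t j) :=
  _root_.measurableSet_acceptance h.measurable_member t (fun s _ => h.measurable_candidate s) j

lemma measurableSet_emptyCapEvent (h : IsUniformModel P v w) (b : PlaneBasis) (δ : ℝ) (t : ℕ) :
    MeasurableSet (emptyCapEvent v w b δ t) :=
  _root_.measurableSet_emptyCapEvent h.measurable_member
    (fun s _ => h.measurable_candidate s) b δ

/-- The state of the group is independent of the next two candidates. -/
lemma prob_emptyCapEvent_inter (h : IsUniformModel P v w) (t : ℕ) (i j : Fin 2) (b : PlaneBasis)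
    (δ : ℝ) {S : Set (Plane × Plane)} (hS : MeasurableSet S) :
    P.real (emptyCapEvent v w b δ t ∩ {ω | (w t i ω, w t j ω) ∈ S}) =
      P.real (emptyCapEvent v w b δ t) * P.real {ω | (w t i ω, w t j ω) ∈ S} := by
  -- The condition is vacuous on `Sum.inl`, so the initial members belong to the past.
  set past : Set (Fin k ⊕ (ℕ × Fin 2)) := {a | ∀ p, a = Sum.inr p → p.1 < t} with hpast
  set next : Set (Fin k ⊕ (ℕ × Fin 2)) := {a | ∃ l, a = Sum.inr (t, l)} with hnext
  have hd : Disjoint past next := by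
    rw [Set.disjoint_left]
    rintro a ha ⟨l, rfl⟩
    exact lt_irrefl _ (ha _ rfl)
  set σ : Set (Fin k ⊕ (ℕ × Fin 2)) → MeasurableSpace Ω := fun A =>
    ⨆ a ∈ A, MeasurableSpace.comap (location v w a) inferInstance with hσ
  have hind : Indep (σ past) (σ next) P :=
    indep_iSup_of_disjoint (fun a => (h.measurable a).comap_le) h.indep.iIndep hd
  have hmeas (A) (a) (ha : a ∈ A) : Measurable[σ A] (location v w a) :=
    measurable_iff_comap_le.2 (le_iSup₂_of_le a ha le_rfl)
  have hE : MeasurableSet[σ past] (emptyCapEvent v w b δ t) := by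
    refine @_root_.measurableSet_emptyCapEvent _ _ _ _ (σ past) (fun i => ?_) _ (fun s hs j => ?_) b δ
    · exact hmeas past (Sum.inl i) (by simp [hpast])
    · exact hmeas past (Sum.inr (s, j)) (by rintro p ⟨⟩; exact hs)
  have hN : MeasurableSet[σ next] {ω | (w t i ω, w t j ω) ∈ S} := by
    have := @Measurable.prodMk Ω (σ next) Plane Plane _ _ _ _ (hmeas next (Sum.inr (t, i)) ⟨i, rfl⟩)
      (hmeas next (Sum.inr (t, j)) ⟨j, rfl⟩)
    exact this hS
  simp only [measureReal_def]
  rw [(Indep_iff _ _ _).1 hind _ _ hE hN, ENNReal.toReal_mul]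

variable [IsProbabilityMeasure P]

lemma measure_pair (h : IsUniformModel P v w) {a a' : Fin k ⊕ (ℕ × Fin 2)} (ha : a ≠ a')
    {S : Set (Plane × Plane)} (hS : MeasurableSet S) :
    P {ω | (location v w a ω, location v w a' ω) ∈ S} =
      (ENNReal.ofReal Real.pi)⁻¹ * (ENNReal.ofReal Real.pi)⁻¹ *
        (volume.prod volume) (S ∩ unitBall ×ˢ unitBall) := by
  have h1 := (indepFun_iff_map_prod_eq_prod_map_map (h.measurable a).aemeasurable
    (h.measurable a').aemeasurable).1 (h.indep.indepFun ha)
  have h2 : P {ω | (location v w a ω, location v w a' ω) ∈ S} =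
      P.map (fun ω => (location v w a ω, location v w a' ω)) S := by
    rw [Measure.map_apply ((h.measurable a).prodMk (h.measurable a')) hS]
    rfl
  rw [h2, h1, h.uniform a, h.uniform a']
  have : volume[|unitBall] = (ENNReal.ofReal Real.pi)⁻¹ • volume.restrict unitBall := by
    rw [ProbabilityTheory.cond, volume_unitBall]
  rw [this, Measure.prod_smul_left, Measure.prod_smul_right, Measure.prod_restrict]
  simp only [Measure.smul_apply, smul_eq_mul]
  rw [Measure.restrict_apply hS, mul_assoc]

/-- Coincidences are null because the diagonal is the shear preimage of a point; there are countably
many pairs of locations. -/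
lemma ae_isGeneric (h : IsUniformModel P v w) : ∀ᵐ ω ∂P, IsGeneric v w ω := by
  have h1 : ∀ a, ∀ᵐ ω ∂P, location v w a ω ∈ unitBall := by
    intro a
    have : ∀ᵐ x ∂(P.map (location v w a)), x ∈ unitBall := by
      rw [h.uniform a, ProbabilityTheory.cond]
      exact Measure.ae_smul_measure (ae_restrict_mem measurableSet_unitBall) _
    exact ae_of_ae_map (h.measurable a).aemeasurable this
  have h2 : ∀ a a', a ≠ a' → ∀ᵐ ω ∂P, location v w a ω ≠ location v w a' ω := by
    intro a a' ha
    have hm : MeasurableSet {z : Plane × Plane | z.1 ∈ Set.univ ∧ z.2 - z.1 ∈ ({0} : Set Plane)} :=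
      measurableSet_shear MeasurableSet.univ (measurableSet_singleton 0)
    have h3 := h.measure_pair ha hm
    have h4 : (volume.prod volume) ({z : Plane × Plane | z.1 ∈ Set.univ ∧
        z.2 - z.1 ∈ ({0} : Set Plane)} ∩ unitBall ×ˢ unitBall) = 0 := by
      refine measure_mono_null Set.inter_subset_left ?_
      rw [volume_prod_shear MeasurableSet.univ (measurableSet_singleton 0)]
      simp
    rw [h4, mul_zero] at h3
    rw [ae_iff]
    refine measure_mono_null ?_ h3
    intro ω hω
    have : location v w a ω = location v w a' ω := by simpa using hω
    simp [this]
  have h1' := ae_all_iff.2 h1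
  have h2' : ∀ᵐ ω ∂P, ∀ a a', a ≠ a' → location v w a ω ≠ location v w a' ω := by
    refine ae_all_iff.2 fun a => ae_all_iff.2 fun a' => ?_
    by_cases ha : a = a'
    · simp [ha]
    · filter_upwards [h2 a a' ha] with ω hω _ using hω
  filter_upwards [h1', h2'] with ω hω hω'
  exact ⟨hω, fun a a' e => by_contra fun hne => hω' a a' hne e⟩

lemma prob_bisectorSet_le (h : IsUniformModel P v w) (t : ℕ) (j : Fin 2) (b : PlaneBasis) {δ : ℝ}
    (hδ : 0 < δ) :
    P.real {ω | (w t j ω, w t (j + 1) ω) ∈ bisectorSet b δ} ≤ 400 * δ ^ 8 := by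
  have hne : (Sum.inr (t, j) : Fin k ⊕ (ℕ × Fin 2)) ≠ Sum.inr (t, j + 1) := by
    fin_cases j <;> simp
  have h1 := h.measure_pair hne (measurableSet_bisectorSet b δ)
  have h2 : P {ω | (w t j ω, w t (j + 1) ω) ∈ bisectorSet b δ} ≤
      ENNReal.ofReal (Real.pi⁻¹ * Real.pi⁻¹ * (3072 * δ ^ 8)) := by
    refine h1.trans_le ?_
    rw [ENNReal.ofReal_mul (by positivity), ENNReal.ofReal_mul (by positivity),
      ENNReal.ofReal_inv_of_pos Real.pi_pos, ← volume_bisectorSet b hδ]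
    gcongr
    exact Set.inter_subset_left
  have h3 := ENNReal.toReal_mono ENNReal.ofReal_ne_top h2
  rw [ENNReal.toReal_ofReal (by positivity)] at h3
  refine h3.trans ?_
  -- The constant 400 works because 3072 / 9 < 400.
  have hp : Real.pi⁻¹ * Real.pi⁻¹ ≤ 3⁻¹ * 3⁻¹ := by
    have := Real.pi_gt_three.le
    gcongr
  have : 0 < δ ^ 8 := by positivity
  nlinarith

lemma prob_successSet_ge (h : IsUniformModel P v w) (t : ℕ) (b : PlaneBasis) {δ : ℝ}
    (hδ : 0 < δ) (hδ1 : δ ≤ 1) :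
    δ ^ 8 / 1000000 ≤ P.real {ω | (w t 0 ω, w t 1 ω) ∈ successSet b δ} := by
  have hne : (Sum.inr (t, 0) : Fin k ⊕ (ℕ × Fin 2)) ≠ Sum.inr (t, 1) := by simp
  have h1 := h.measure_pair hne (measurableSet_successSet b δ)
  have hs : successSet b δ ∩ unitBall ×ˢ unitBall = successSet b δ :=
    Set.inter_eq_left.2 fun z hz => successSet_subset_unitBall hδ hδ1 hz
  rw [hs, volume_successSet b hδ, ← ENNReal.ofReal_inv_of_pos Real.pi_pos,
    ← ENNReal.ofReal_mul (by positivity), ← ENNReal.ofReal_mul (by positivity)] at h1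
  have h2 : P.real {ω | (w t 0 ω, w t 1 ω) ∈ successSet b δ} =
      Real.pi⁻¹ * Real.pi⁻¹ * (δ ^ 8 / 100000) := by
    refine (congrArg ENNReal.toReal h1).trans ?_
    rw [ENNReal.toReal_ofReal (by positivity)]
  rw [h2]
  have hp : (1 : ℝ) / 10 ≤ Real.pi⁻¹ * Real.pi⁻¹ := by
    rw [← mul_inv, ← one_div]
    have := Real.pi_pos
    refine one_div_le_one_div_of_le (by positivity) ?_
    nlinarith [Real.pi_lt_d2]
  have : 0 < δ ^ 8 := by positivity
  nlinarith

lemma integrable_indicator {S : Set Ω} (hS : MeasurableSet S) :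
    Integrable (S.indicator (1 : Ω → ℝ)) P :=
  (integrable_const 1).indicator hS

lemma integrable_sum_acceptance (h : IsUniformModel P v w) (t : ℕ) :
    Integrable (fun ω => ∑ s ∈ Finset.range t, ∑ j,
      (acceptance v w s j).indicator (1 : Ω → ℝ) ω) P :=
  integrable_finsetSum _ fun s _ => integrable_finsetSum _ fun j _ =>
    integrable_indicator (h.measurableSet_acceptance s j)

lemma ae_card_eq (h : IsUniformModel P v w) (t : ℕ) :
    (fun ω => ((randomGroup v w t ω).card : ℝ)) =ᵐ[P] fun ω =>
      k + ∑ s ∈ Finset.range t, ∑ j, (acceptance v w s j).indicator (1 : Ω → ℝ) ω := by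
  filter_upwards [h.ae_isGeneric] with ω hω using hω.card_randomGroup t

lemma integrable_card (h : IsUniformModel P v w) (t : ℕ) :
    Integrable (fun ω => ((randomGroup v w t ω).card : ℝ)) P :=
  ((integrable_const _).add (h.integrable_sum_acceptance t)).congr (h.ae_card_eq t).symm

lemma integral_card (h : IsUniformModel P v w) (t : ℕ) :
    ∫ ω, ((randomGroup v w t ω).card : ℝ) ∂P =
      k + ∑ s ∈ Finset.range t, ∑ j, P.real (acceptance v w s j) := by
  rw [integral_congr_ae (h.ae_card_eq t), integral_add (integrable_const _)
    (h.integrable_sum_acceptance t), integral_finsetSum]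
  · simp only [integral_const, probReal_univ, one_smul]
    congr 1
    refine Finset.sum_congr rfl fun s _ => ?_
    rw [integral_finsetSum]
    · exact Finset.sum_congr rfl fun j _ => integral_indicator_one (h.measurableSet_acceptance s j)
    · exact fun j _ => integrable_indicator (h.measurableSet_acceptance s j)
  · exact fun s _ => integrable_finsetSum _ fun j _ =>
      integrable_indicator (h.measurableSet_acceptance s j)

/-! ### Lower bound -/

lemma sum_prob_emptyCapEvent_ge (h : IsUniformModel P v w) (n t : ℕ) :
    n - ∫ ω, ((randomGroup v w t ω).card : ℝ) ∂P ≤ ∑ i ∈ Finset.range n,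
      P.real (emptyCapEvent v w (angleBasis (i / n)) (1 / (4 * n)) t) := by
  have hm (i : ℕ) := h.measurableSet_emptyCapEvent (angleBasis (i / n)) (1 / (4 * n)) t
  have h1 : ∑ i ∈ Finset.range n, P.real (emptyCapEvent v w (angleBasis (i / n)) (1 / (4 * n)) t)ᶜ
      ≤ ∫ ω, ((randomGroup v w t ω).card : ℝ) ∂P := by
    simp_rw [← integral_indicator_one (hm _).compl]
    rw [← integral_finsetSum _ fun i _ => integrable_indicator (hm i).compl]
    refine integral_mono_ae (integrable_finsetSum _ fun i _ => integrable_indicator (hm i).compl)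
      (h.integrable_card t) ?_
    filter_upwards [h.ae_isGeneric] with ω hω using hω.sum_indicator_compl_emptyCapEvent_le n t
  simp_rw [probReal_compl_eq_one_sub (hm _)] at h1
  rw [Finset.sum_sub_distrib, Finset.sum_const, Finset.card_range, nsmul_eq_mul, mul_one] at h1
  linarith

/-- The `n` success events are disjoint, since they place the first candidate in disjoint caps, so
their probabilities add up. -/
lemma prob_acceptance_ge (h : IsUniformModel P v w) {n : ℕ} (hn : 1 ≤ n) (t : ℕ) :
    (n - ∫ ω, ((randomGroup v w t ω).card : ℝ) ∂P) * ((1 / (4 * n) : ℝ) ^ 8 / 1000000) ≤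
      P.real (acceptance v w t 0) := by
  have hn' : (1 : ℝ) ≤ n := by exact_mod_cast hn
  set δ : ℝ := 1 / (4 * n) with hδ
  have hδ0 : 0 < δ := by positivity
  have hδ1 : δ ≤ 1 := by
    rw [hδ, div_le_one (by positivity)]; linarith
  set b : ℕ → PlaneBasis := fun i => angleBasis (i / n) with hb
  set F : ℕ → Set Ω := fun i =>
    emptyCapEvent v w (b i) δ t ∩ {ω | (w t 0 ω, w t 1 ω) ∈ successSet (b i) δ} with hF
  have hFm (i : ℕ) : MeasurableSet (F i) := (h.measurableSet_emptyCapEvent _ _ _).inter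
    (h.measurable_pair t 0 1 (measurableSet_successSet _ _))
  have hFd : (↑(Finset.range n) : Set ℕ).PairwiseDisjoint F := by
    intro i hi j hj hij
    refine Set.disjoint_left.2 fun ω hωi hωj => hij ?_
    exact caps_disjoint (Finset.mem_range.1 hi) (Finset.mem_range.1 hj)
      (successSet_subset_unitBall hδ0 hδ1 hωi.2).1 (first_mem_cap_of_mem_successSet hδ0 hωi.2)
      (first_mem_cap_of_mem_successSet hδ0 hωj.2)
  calc _ ≤ (∑ i ∈ Finset.range n, P.real (emptyCapEvent v w (b i) δ t)) * (δ ^ 8 / 1000000) := by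
        gcongr
        exact h.sum_prob_emptyCapEvent_ge n t
    _ ≤ ∑ i ∈ Finset.range n, P.real (F i) := by
        rw [Finset.sum_mul]
        refine Finset.sum_le_sum fun i _ => ?_
        rw [h.prob_emptyCapEvent_inter t 0 1 _ _ (measurableSet_successSet _ _)]
        gcongr
        exact h.prob_successSet_ge t (b i) hδ0 hδ1
    _ = P.real (⋃ i ∈ Finset.range n, F i) :=
        (measureReal_biUnion_finset hFd fun i _ => hFm i).symm
    _ ≤ P.real (acceptance v w t 0) := by
        refine ENNReal.toReal_mono (measure_ne_top _ _) (measure_mono_ae ?_)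
        filter_upwards [h.ae_isGeneric] with ω hω hωF
        obtain ⟨i, -, hi⟩ := Set.mem_iUnion₂.1 hωF
        exact hω.mem_acceptance_of_mem_successSet hδ0 hδ1 hi.1 hi.2

lemma integral_card_mono (h : IsUniformModel P v w) {s t : ℕ} (hst : s ≤ t) :
    ∫ ω, ((randomGroup v w s ω).card : ℝ) ∂P ≤ ∫ ω, ((randomGroup v w t ω).card : ℝ) ∂P :=
  integral_mono (h.integrable_card s) (h.integrable_card t) fun ω =>
    Nat.cast_le.2 (Finset.card_le_card (randomGroup_mono ω hst))

lemma le_integral_card_pow (h : IsUniformModel P v w) (hk : 1 ≤ k) (T : ℕ) :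
    (T : ℝ) / (12 ^ 8 * 1000000) ≤ (∫ ω, ((randomGroup v w T ω).card : ℝ) ∂P) ^ 8 := by
  obtain ⟨a, ha⟩ : ∃ a, a = ∫ ω, ((randomGroup v w T ω).card : ℝ) ∂P := ⟨_, rfl⟩
  rw [← ha]
  have hk' : (1 : ℝ) ≤ k := by exact_mod_cast hk
  have hint := h.integral_card T
  rw [← ha] at hint
  have ha1 : 1 ≤ a := by
    rw [hint]
    have : 0 ≤ ∑ s ∈ Finset.range T, ∑ j, P.real (acceptance v w s j) := by positivity
    linarith
  -- With n ≥ 2a, at least a caps are empty on average; n < 2a + 1 ≤ 3a gives 4n ≤ 12a, the source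
  -- of the 12.
  obtain ⟨n, hn1, hn2⟩ : ∃ n : ℕ, 2 * a ≤ n ∧ (n : ℝ) < 2 * a + 1 :=
    ⟨⌈2 * a⌉₊, Nat.le_ceil _, Nat.ceil_lt_add_one (by linarith)⟩
  have hn0 : 1 ≤ n := by
    have : (1 : ℝ) ≤ n := by linarith
    exact_mod_cast this
  have hnp : (0 : ℝ) < n := by linarith
  have h1 : ∀ s ∈ Finset.range T, a * ((1 / (12 * a)) ^ 8 / 1000000) ≤
      ∑ j, P.real (acceptance v w s j) := by
    intro s hs
    rw [Fin.sum_univ_two]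
    have h2 := h.prob_acceptance_ge hn0 s
    have h3 := h.integral_card_mono (Finset.mem_range.1 hs).le
    rw [← ha] at h3
    have ha0 : 0 < a := by linarith
    have h4 : a * ((1 / (12 * a)) ^ 8 / 1000000) ≤
        (n - ∫ ω, ((randomGroup v w s ω).card : ℝ) ∂P) * ((1 / (4 * n) : ℝ) ^ 8 / 1000000) := by
      have h5 : a ≤ n - ∫ ω, ((randomGroup v w s ω).card : ℝ) ∂P := by linarith
      have h6 : 4 * (n : ℝ) ≤ 12 * a := by linarith
      have h7 := ha0.le.trans h5
      gcongr
    have h7 : 0 ≤ P.real (acceptance v w s 1) := measureReal_nonneg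
    linarith
  have h2 := Finset.sum_le_sum h1
  rw [Finset.sum_const, Finset.card_range, nsmul_eq_mul] at h2
  have h3 : (T : ℝ) * (a * ((1 / (12 * a)) ^ 8 / 1000000)) ≤ a := by linarith
  have h4 : (T : ℝ) * (a * ((1 / (12 * a)) ^ 8 / 1000000)) =
      a * ((T : ℝ) / (12 ^ 8 * 1000000) / a ^ 8) := by
    rw [div_pow, one_pow, mul_pow]
    ring
  rw [h4] at h3
  have h5 : (T : ℝ) / (12 ^ 8 * 1000000) / a ^ 8 ≤ 1 :=
    le_of_mul_le_mul_left (by linarith) (by linarith : 0 < a)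
  rwa [div_le_one (by positivity)] at h5

/-! ### Upper bound -/

/-- A cap is filled with probability at least `c * δ ^ 8` in each round in which it is empty. -/
lemma sum_prob_emptyCapEvent_le (h : IsUniformModel P v w) (b : PlaneBasis) {δ : ℝ}
    (hδ : 0 < δ) (hδ1 : δ ≤ 1) (T : ℕ) :
    (∑ t ∈ Finset.range T, P.real (emptyCapEvent v w b δ t)) * δ ^ 8 ≤ 1000000 := by
  set F : ℕ → Set Ω := fun t =>
    emptyCapEvent v w b δ t ∩ {ω | (w t 0 ω, w t 1 ω) ∈ successSet b δ} with hF
  have hFm (t : ℕ) : MeasurableSet (F t) := (h.measurableSet_emptyCapEvent _ _ _).inter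
    (h.measurable_pair t 0 1 (measurableSet_successSet _ _))
  -- A cap can be filled from empty only once, so the probabilities of these events sum to at most
  -- 1.
  have hFd' : ∀ s t, s < t → AEDisjoint P (F s) (F t) := by
    intro s t hst
    have : ∀ᵐ ω ∂P, ω ∉ F s ∩ F t := by
      filter_upwards [h.ae_isGeneric] with ω hω hωF
      exact hω.notMem_emptyCapEvent hst hδ hδ1 hωF.1.1 hωF.1.2 hωF.2.1
    simpa [AEDisjoint, ae_iff] using this
  have hFd : (↑(Finset.range T) : Set ℕ).Pairwise (Function.onFun (AEDisjoint P) F) := by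
    intro s _ t _ hst
    rcases hst.lt_or_gt with hst | hst
    · exact hFd' s t hst
    · exact (hFd' t s hst).symm
  have h1 := measure_biUnion_finset₀ hFd fun t _ => (hFm t).nullMeasurableSet
  have h2 : ∑ t ∈ Finset.range T, P.real (F t) ≤ 1 := by
    simp only [measureReal_def]
    rw [← ENNReal.toReal_sum fun _ _ => measure_ne_top _ _, ← h1]
    exact measureReal_le_one
  have h3 : (∑ t ∈ Finset.range T, P.real (emptyCapEvent v w b δ t)) * (δ ^ 8 / 1000000) ≤
      ∑ t ∈ Finset.range T, P.real (F t) := by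
    rw [Finset.sum_mul]
    refine Finset.sum_le_sum fun t _ => ?_
    rw [h.prob_emptyCapEvent_inter t 0 1 _ _ (measurableSet_successSet _ _)]
    gcongr
    exact h.prob_successSet_ge t b hδ hδ1
  linarith

/-- Union bound over the alternatives of `exists_bisectorSet`; emptiness of a cap is independent of
the new pair. -/
lemma prob_acceptance_le (h : IsUniformModel P v w) (J t : ℕ) (j : Fin 2) :
    P.real (acceptance v w t j) ≤
      (∑ _i ∈ Finset.range (26 * 2 ^ J), 400 * ((1 / 2 : ℝ) ^ J) ^ 8) +
      ∑ m ∈ Finset.range J, ∑ i ∈ Finset.range (26 * 2 ^ m),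
        400 * ((1 / 2 : ℝ) ^ m) ^ 8 *
          P.real (emptyCapEvent v w (netBasis m i) ((1 / 2) ^ m) t) := by
  set B : ℕ → ℕ → Set Ω := fun m i =>
    {ω | (w t j ω, w t (j + 1) ω) ∈ bisectorSet (netBasis m i) ((1 / 2) ^ m)} with hB
  set E : ℕ → ℕ → Set Ω := fun m i => emptyCapEvent v w (netBasis m i) ((1 / 2) ^ m) t with hE
  have h1 : P.real (acceptance v w t j) ≤ P.real ((⋃ i ∈ Finset.range (26 * 2 ^ J), B J i) ∪
      ⋃ m ∈ Finset.range J, ⋃ i ∈ Finset.range (26 * 2 ^ m), E m i ∩ B m i) := by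
    refine ENNReal.toReal_mono (measure_ne_top _ _) (measure_mono_ae ?_)
    filter_upwards [h.ae_isGeneric] with ω hω hωa
    rcases hω.exists_bisectorSet_of_mem_acceptance hωa J with ⟨i, hi, h1⟩ | ⟨m, hm, i, hi, h1, h2⟩
    · exact Or.inl (Set.mem_iUnion₂.2 ⟨i, Finset.mem_range.2 hi, h1⟩)
    · exact Or.inr (Set.mem_iUnion₂.2 ⟨m, Finset.mem_range.2 hm,
        Set.mem_iUnion₂.2 ⟨i, Finset.mem_range.2 hi, h2, h1⟩⟩)
  refine h1.trans ((measureReal_union_le _ _).trans (add_le_add ?_ ?_))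
  · refine (measureReal_biUnion_finset_le _ _).trans (Finset.sum_le_sum fun i _ => ?_)
    exact h.prob_bisectorSet_le t j _ (by positivity)
  · refine (measureReal_biUnion_finset_le _ _).trans (Finset.sum_le_sum fun m _ => ?_)
    refine (measureReal_biUnion_finset_le _ _).trans (Finset.sum_le_sum fun i _ => ?_)
    rw [h.prob_emptyCapEvent_inter t j (j + 1) _ _ (measurableSet_bisectorSet _ _), mul_comm]
    gcongr
    exact h.prob_bisectorSet_le t j _ (by positivity)

lemma sum_prob_acceptance_le (h : IsUniformModel P v w) (J T : ℕ) (hT : T < 2 ^ (8 * (J + 1)))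
    (j : Fin 2) :
    ∑ t ∈ Finset.range T, P.real (acceptance v w t j) ≤ 11000000000 * 2 ^ J := by
  have h1 := Finset.sum_le_sum fun t (_ : t ∈ Finset.range T) => h.prob_acceptance_le J t j
  refine h1.trans ?_
  rw [Finset.sum_add_distrib]
  -- The last scale: T < 256 · 2^(8J) rounds cancel the factor 2^(-8J), and 10400 = 26 · 400.
  have hA : ∑ _t ∈ Finset.range T, ∑ _i ∈ Finset.range (26 * 2 ^ J), 400 * ((1 / 2 : ℝ) ^ J) ^ 8 ≤
      10400 * 256 * 2 ^ J := by
    simp only [Finset.sum_const, Finset.card_range, nsmul_eq_mul]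
    have hT' : (T : ℝ) ≤ 2 ^ (8 * (J + 1)) := by exact_mod_cast hT.le
    have e : (2 : ℝ) ^ J * (1 / 2) ^ J = 1 := by rw [← mul_pow]; norm_num
    calc (T : ℝ) * (((26 * 2 ^ J : ℕ) : ℝ) * (400 * ((1 / 2 : ℝ) ^ J) ^ 8))
        ≤ 2 ^ (8 * (J + 1)) * (((26 * 2 ^ J : ℕ) : ℝ) * (400 * ((1 / 2 : ℝ) ^ J) ^ 8)) := by gcongr
      _ = 10400 * 256 * 2 ^ J * (2 ^ J * (1 / 2 : ℝ) ^ J) ^ 8 := by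
          push_cast
          rw [mul_add, pow_add, mul_comm 8 J, pow_mul]
          ring
      _ = _ := by rw [e]; ring
  have hB : ∑ t ∈ Finset.range T, ∑ m ∈ Finset.range J, ∑ i ∈ Finset.range (26 * 2 ^ m),
      400 * ((1 / 2 : ℝ) ^ m) ^ 8 * P.real (emptyCapEvent v w (netBasis m i) ((1 / 2) ^ m) t) ≤
      10400000000 * 2 ^ J := by
    rw [Finset.sum_comm]
    have hm : ∀ m ∈ Finset.range J, ∑ t ∈ Finset.range T, ∑ i ∈ Finset.range (26 * 2 ^ m),
        400 * ((1 / 2 : ℝ) ^ m) ^ 8 * P.real (emptyCapEvent v w (netBasis m i) ((1 / 2) ^ m) t) ≤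
        10400000000 * 2 ^ m := by
      intro m _
      rw [Finset.sum_comm]
      -- The δ^8 of a pair cancels the δ^(-8) rounds of emptiness, so each cap contributes a
      -- constant, 400 · 10^6.
      have hi : ∀ i ∈ Finset.range (26 * 2 ^ m), ∑ t ∈ Finset.range T,
          400 * ((1 / 2 : ℝ) ^ m) ^ 8 *
            P.real (emptyCapEvent v w (netBasis m i) ((1 / 2) ^ m) t) ≤ 400000000 := by
        intro i _
        rw [← Finset.mul_sum]
        have := h.sum_prob_emptyCapEvent_le (netBasis m i) (δ := (1 / 2) ^ m) (by positivity)
          (pow_le_one₀ (by norm_num) (by norm_num)) T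
        linarith
      refine (Finset.sum_le_sum hi).trans_eq ?_
      simp only [Finset.sum_const, Finset.card_range, nsmul_eq_mul]
      push_cast
      ring
    refine (Finset.sum_le_sum hm).trans ?_
    rw [← Finset.mul_sum, geom_sum_eq (by norm_num)]
    norm_num
  have : (0 : ℝ) < 2 ^ J := by positivity
  linarith

lemma integral_card_le (h : IsUniformModel P v w) (J T : ℕ) (hT : T < 2 ^ (8 * (J + 1))) :
    ∫ ω, ((randomGroup v w T ω).card : ℝ) ∂P ≤ k + 22000000000 * 2 ^ J := by
  rw [h.integral_card, Finset.sum_comm, Fin.sum_univ_two]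
  linarith [h.sum_prob_acceptance_le J T hT 0, h.sum_prob_acceptance_le J T hT 1]

end IsUniformModel

/-! ### Choice of the last scale and conclusion -/

lemma exists_dyadic_scale {T : ℕ} (hT : 1 ≤ T) :
    ∃ J : ℕ, T < 2 ^ (8 * (J + 1)) ∧ (2 : ℝ) ^ J ≤ (T : ℝ) ^ (1 / 8 : ℝ) := by
  refine ⟨Nat.log (2 ^ 8) T, ?_, ?_⟩
  · rw [pow_mul]
    exact Nat.lt_pow_succ_log_self (by norm_num) T
  · have h1 : ((2 ^ 8) ^ Nat.log (2 ^ 8) T : ℕ) ≤ T := Nat.pow_log_le_self _ (by omega)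
    have h2 : ((2 : ℝ) ^ Nat.log (2 ^ 8) T) ^ (8 : ℕ) ≤ T := by
      rw [← pow_mul, mul_comm, pow_mul]
      exact_mod_cast h1
    rw [one_div]
    rw [Real.le_rpow_inv_iff_of_pos (by positivity) (by positivity) (by norm_num)]
    exact_mod_cast h2

theorem theorem2 (k : ℕ) (hk : 1 ≤ k) :
    ∃ c C : ℝ, 0 < c ∧ 0 < C ∧
      ∀ (Ω : Type*) [MeasurableSpace Ω] (P : Measure Ω) [IsProbabilityMeasure P]
        (v : Fin k → Ω → Plane) (w : ℕ → Fin 2 → Ω → Plane),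
        (∀ i, Measurable (v i)) → (∀ t j, Measurable (w t j)) →
        (∀ i, pdf.IsUniform (v i) unitBall P volume) →
        (∀ t j, pdf.IsUniform (w t j) unitBall P volume) →
        iIndepFun (β := fun _ : Fin k ⊕ (ℕ × Fin 2) => Plane)
          (Sum.elim v (fun p : ℕ × Fin 2 => w p.1 p.2)) P →
        ∀ T : ℕ, 1 ≤ T →
          Integrable (fun ω => ((randomGroup v w T ω).card : ℝ)) P ∧
          c * (T : ℝ) ^ (1 / 8 : ℝ) ≤ ∫ ω, ((randomGroup v w T ω).card : ℝ) ∂P ∧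
          ∫ ω, ((randomGroup v w T ω).card : ℝ) ∂P ≤ C * (T : ℝ) ^ (1 / 8 : ℝ) := by
  refine ⟨(1 / (12 ^ 8 * 1000000) : ℝ) ^ (1 / 8 : ℝ), k + 22000000000, by positivity, by positivity,
    ?_⟩
  intro Ω _ P _ v w hv hw huv huw hind T hT
  have h : IsUniformModel P v w := ⟨by rintro (i | ⟨t, j⟩); exacts [hv i, hw t j],
    by rintro (i | ⟨t, j⟩); exacts [huv i, huw t j], hind⟩
  refine ⟨h.integrable_card T, ?_, ?_⟩
  · have ha : 0 ≤ ∫ ω, ((randomGroup v w T ω).card : ℝ) ∂P :=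
      integral_nonneg fun ω => Nat.cast_nonneg _
    rw [← Real.mul_rpow (by positivity) (by positivity), one_div (8 : ℝ),
      Real.rpow_inv_le_iff_of_pos (by positivity) ha (by norm_num)]
    have := h.le_integral_card_pow hk T
    rw [one_div_mul_eq_div]
    exact_mod_cast this
  · obtain ⟨J, hJ, hJ'⟩ := exists_dyadic_scale hT
    -- This absorbs the `k` initial members into the constant.
    have h1 : (1 : ℝ) ≤ (T : ℝ) ^ (1 / 8 : ℝ) :=
      Real.one_le_rpow (by exact_mod_cast hT) (by norm_num)
    have h2 : (k : ℝ) * 1 ≤ k * (T : ℝ) ^ (1 / 8 : ℝ) := by gcongr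
    linarith [h.integral_card_le J T hJ]
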